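/- For a partially ordered set $P$, let $\mathbf{Co}(P)$ denote the lattice of all order-convex subsets of $P$, ordered by inclusion (a subset $X$ of $P$ is order-convex if $x\le z\le y$ with $x,y\in X$ and $z\in P$ implies $z\in X$). For a positive integer $N$, write $\mathbf{Co}(N)$ for $\mathbf{Co}(\{0,1,\dots,N-1\})$, where $\{0,1,\dots,N-1\}$ carries its natural linear order. For positive integers $m$ and $n$, let $L_{m,n}$ be the sublattice $$L_{m,n}=\{X\in\mathbf{Co}(m+n+1) : m\in X\Rightarrow m-1\in X\}$$ of $\mathbf{Co}(m+n+1)$. For a lattice $L$, let $\mathbf{V}(L)$ denote the variety of lattices generated by $L$, that is, the smallest class of lattices that is defined by a set of lattice identities and contains $L$. Let $m,n,m',n'$ be positive integers such that $m+n=m'+n'$. If $L_{m,n}$ belongs to $\mathbf{V}(L_{m',n'})$, then $(m,n)=(m',n')$. In particular, the varieties $\mathbf{V}(L_{k,l})$ with $k,l$ positive integers and $k+l$ fixed are mutually incomparable: if $k,l,k',l'$ are positive integers with $k+l=k'+l'$ and $(k,l)\neq(k',l')$, then neither of $\mathbf{V}(L_{k,l})$ and $\mathbf{V}(L_{k',l'})$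 is contained in the other. -/

import Mathlib

namespace ConvexLattice

/-! ### Lattices of order-convex subsets -/

/-- `Co P` is the set of all order-convex subsets of the poset `P`: the sets `X` such that
`x ≤ z ≤ y` with `x, y ∈ X` implies `z ∈ X`. -/
structure Co (P : Type*) [PartialOrder P] where
  /-- The underlying set. -/
  carrier : Set P
  ordConnected' : carrier.OrdConnected

namespace Co

variable {P : Type*} [PartialOrder P]

instance : SetLike (Co P) P where
  coe X := X.carrier
  coe_injective X Y h := by cases X; cases Y; congr

/-- Order-convex sets are ordered by inclusion. -/
instance : PartialOrder (Co P) := .ofSetLike (Co P) P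

/-- The meet is the intersection; the join is the least order-convex set that contains the
union, i.e. the set of all points lying between two points of the union. -/
instance : Lattice (Co P) where
  inf X Y := ⟨X.carrier ∩ Y.carrier, X.ordConnected'.inter Y.ordConnected'⟩
  inf_le_left _ _ _ h := h.1
  inf_le_right _ _ _ h := h.2
  le_inf _ _ _ h₁ h₂ _ h := ⟨h₁ h, h₂ h⟩
  sup X Y := ⟨{z | ∃ x ∈ X.carrier ∪ Y.carrier, ∃ y ∈ X.carrier ∪ Y.carrier, x ≤ z ∧ z ≤ y}, ⟨by
    rintro a ⟨x, hx, -, -, hxa, -⟩ b ⟨-, -, y, hy, -, hby⟩ c ⟨hac, hcb⟩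
    exact ⟨x, hx, y, hy, hxa.trans hac, hcb.trans hby⟩⟩⟩
  le_sup_left _ _ z hz := ⟨z, Or.inl hz, z, Or.inl hz, le_rfl, le_rfl⟩
  le_sup_right _ _ z hz := ⟨z, Or.inr hz, z, Or.inr hz, le_rfl, le_rfl⟩
  sup_le _ _ Z h₁ h₂ _ := by
    rintro ⟨x, hx, y, hy, hxz, hzy⟩
    exact Z.ordConnected'.out (hx.elim (fun h => h₁ h) (fun h => h₂ h))
      (hy.elim (fun h => h₁ h) (fun h => h₂ h)) ⟨hxz, hzy⟩

end Co

/-- The lattice `L_{m,n}`: the sublattice of `Co {0, 1, …, m + n}` consisting of those `X` for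
which `m ∈ X` implies `m - 1 ∈ X`. It is used for positive `m` and `n` only. -/
def Lmn (m n : ℕ) : Sublattice (Co (Fin (m + n + 1))) where
  carrier := {X | (⟨m, by omega⟩ : Fin (m + n + 1)) ∈ X → (⟨m - 1, by omega⟩ : Fin (m + n + 1)) ∈ X}
  supClosed' := by
    rintro X hX Y hY ⟨x, hx, y, hy, hxm, hmy⟩
    rcases eq_or_lt_of_le hxm with h | h
    · subst h
      rcases hx with hx | hx
      · exact (le_sup_left : X ≤ X ⊔ Y) (hX hx)
      · exact (le_sup_right : Y ≤ X ⊔ Y) (hY hx)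
    · refine ⟨x, hx, y, hy, ?_, le_trans ?_ hmy⟩
      · exact Fin.le_def.2 (Nat.le_sub_one_of_lt (Fin.lt_def.1 h))
      · exact Fin.le_def.2 (Nat.sub_le _ _)
  infClosed' := fun _ hX _ hY h => ⟨hX h.1, hY h.2⟩

/-! ### Lattice identities and varieties -/

/-- Lattice terms in the variables `x₀, x₁, x₂, …`. -/
inductive LatticeTerm : Type
  | var (i : ℕ) : LatticeTerm
  | join (s t : LatticeTerm) : LatticeTerm
  | meet (s t : LatticeTerm) : LatticeTerm

/-- The value of a lattice term in the lattice `K` under the assignment `v`. -/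
def LatticeTerm.eval {K : Type*} [Lattice K] (v : ℕ → K) : LatticeTerm → K
  | .var i => v i
  | .join s t => s.eval v ⊔ t.eval v
  | .meet s t => s.eval v ⊓ t.eval v

/-- The lattice `K` satisfies the identity `e.1 = e.2`. -/
def Satisfies (K : Type*) [Lattice K] (e : LatticeTerm × LatticeTerm) : Prop :=
  ∀ v : ℕ → K, e.1.eval v = e.2.eval v

/-- A variety of lattices: the class of all lattices that satisfy a given set of identities. -/
def IsVariety (𝒱 : Set Lat) : Prop :=
  ∃ E : Set (LatticeTerm × LatticeTerm), 𝒱 = {K : Lat | ∀ e ∈ E, Satisfies K e}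

/-- `V L` is the variety of lattices generated by the lattice `L`, i.e. the least variety that
contains `L`. -/
def V (L : Type*) [Lattice L] : Set Lat :=
  ⋂₀ {𝒱 : Set Lat | IsVariety 𝒱 ∧ Lat.of L ∈ 𝒱}

end ConvexLattice

/-! The pair `{m - 1} < {m - 1, m}` is critical: a unary polynomial moves any `a < b` onto it. With
finiteness of both lattices, this gives a form of Jónsson's lemma, which makes `Lmn m n` a
homomorphic image of a sublattice of `Lmn m' n'` (`exists_lift_of_critical_pair`).

Let `A i` be the least preimage of the smallest member containing `i`, and `e` the greatest preimage
of `∅`. Each `A i` has a point `f i` outside `e`, and outside `A (m - 1)` if `i = m`. Distinct `i`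
get distinct points, so by `m + n = m' + n'` the map `f` is a bijection, and each `A i` with `i ≠ m`
is the singleton `{f i}`. Joins make `f` preserve betweenness, hence it is monotone or antitone. As
`m'` never occurs without `m' - 1`, only `f m` can be `m'`; this also excludes the antitone case. So
`f` is the identity on values and `m = m'`. -/

namespace ConvexLattice

/-! ### Lattice terms -/

namespace LatticeTerm

/-- Renaming of the variables of a lattice term. -/
def rename (r : ℕ → ℕ) : LatticeTerm → LatticeTerm
  | var i => var (r i)
  | join s t => join (s.rename r) (t.rename r)
  | meet s t => meet (s.rename r) (t.rename r)

theorem eval_rename {K : Type*} [Lattice K] (r : ℕ → ℕ) (v : ℕ → K) (t : LatticeTerm) :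
    (t.rename r).eval v = t.eval (v ∘ r) := by
  induction t with
  | var i => rfl
  | join s t hs ht => simp only [rename, eval, hs, ht]
  | meet s t hs ht => simp only [rename, eval, hs, ht]

end LatticeTerm

open LatticeTerm

/-! ### Varieties -/

universe u

theorem of_mem_V (L : Type*) [Lattice L] : Lat.of L ∈ V L :=
  Set.mem_sInter.2 fun _ h => h.2

theorem Satisfies.of_mem_V {L L' : Type u} [Lattice L] [Lattice L'] (h : Lat.of L ∈ V L')
    {e : LatticeTerm × LatticeTerm} (he : Satisfies L' e) : Satisfies L e :=
  Set.mem_sInter.1 h {K : Lat | ∀ e ∈ {e | Satisfies L' e}, Satisfies K e}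
    ⟨⟨_, rfl⟩, fun _ h => h⟩ e he

/-- A form of Jónsson's lemma. If every pair `a < b` of `L` can be moved to the pair `q < p` by a
unary polynomial and `L` satisfies all identities of the finite lattice `L'`, then for some
assignment in `L'`, every inequality between terms that holds there holds in `L`. -/
theorem exists_assignment_of_critical_pair {L L' : Type*} [Lattice L] [Lattice L'] [Finite L]
    [Finite L'] (hV : ∀ e, Satisfies L' e → Satisfies L e) {p q : L} (hqp : q < p)
    (hcrit : ∀ a b : L, a < b → ∃ c x : L, (a ⊓ c ⊔ x) ⊓ p ≤ q ∧ p ≤ b ⊓ c ⊔ x)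
    (r : ℕ → L) (e : L → ℕ) (hre : ∀ x, r (e x) = x) :
    ∃ w : ℕ → L', ∀ s t : LatticeTerm, s.eval w ≤ t.eval w → s.eval r ≤ t.eval r := by
  classical
  by_contra! hcon
  have key : ∀ F : Finset (L → L'), ∃ S T : LatticeTerm,
      (∀ w ∈ F, S.eval (w ∘ r) = T.eval (w ∘ r)) ∧ (∀ u : ℕ → L', S.eval u ≤ T.eval u) ∧
      S.eval r = q ∧ T.eval r = p := by
    intro F
    induction F using Finset.induction_on with
    | empty =>
      refine ⟨meet (var (e q)) (var (e p)), var (e p), by simp, fun u => inf_le_right, ?_, hre p⟩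
      simp only [eval, hre]
      exact inf_eq_left.2 hqp.le
    | insert w F _ ih =>
      obtain ⟨S₁, T₁, h₁, le₁, S₁q, T₁p⟩ := ih
      obtain ⟨s, t, hst, hnst⟩ := hcon (w ∘ r)
      obtain ⟨c, x, hq, hp⟩ := hcrit (s.eval r ⊓ t.eval r) (s.eval r)
        (lt_of_le_of_ne inf_le_left fun h => hnst (inf_eq_left.1 h))
      -- Clipping the polynomial to the interval from `q` to `p` turns the two inequalities of
      -- `hcrit` into equalities.
      let f : LatticeTerm → LatticeTerm := fun a =>
        join (meet (join (meet a (var (e c))) (var (e x))) (var (e p))) (var (e q))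
      have le₂ (u : ℕ → L') : (f (meet s t)).eval u ≤ (f s).eval u := by
        simp only [f, eval]
        gcongr
        exact inf_le_left
      have h₂ : (f (meet s t)).eval (w ∘ r) = (f s).eval (w ∘ r) := by
        simp only [f, eval, inf_eq_left.2 hst]
      have S₂q : (f (meet s t)).eval r = q := by
        simp only [f, eval, hre]
        exact sup_eq_right.2 hq
      have T₂p : (f s).eval r = p := by
        simp only [f, eval, hre]
        rw [inf_eq_right.2 hp, sup_eq_left.2 hqp.le]
      clear_value f
      -- The new pair collapses wherever either of the two old pairs does, but at `r` it still
      -- evaluates to `q < p`.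
      refine ⟨join (meet T₁ (f (meet s t))) (meet S₁ (f s)), meet T₁ (f s), ?_, ?_, ?_, ?_⟩
      · intro w' hw'
        rcases Finset.mem_insert.1 hw' with rfl | hw'
        · rw [eval, eval, eval, eval, h₂]
          exact sup_eq_left.2 (inf_le_inf_right _ (le₁ _))
        · rw [eval, eval, eval, eval, h₁ w' hw']
          exact sup_eq_right.2 (inf_le_inf_left _ (le₂ _))
      · intro u
        exact sup_le (inf_le_inf_left _ (le₂ u)) (inf_le_inf_right _ (le₁ u))
      · rw [eval, eval, eval, S₂q, T₂p, S₁q, T₁p, inf_eq_right.2 hqp.le, inf_eq_left.2 hqp.le,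
          sup_idem]
      · rw [eval, T₁p, T₂p, inf_idem]
  have := Fintype.ofFinite (L → L')
  obtain ⟨S, T, hST, -, hS, hT⟩ := key Finset.univ
  -- Renaming by `e ∘ r` identifies variables with the same value in `L`, so finitely many
  -- assignments in `L'` account for all.
  have h := hV (S.rename (e ∘ r), T.rename (e ∘ r)) (fun w => by
    rw [eval_rename, eval_rename]
    exact hST (w ∘ e) (Finset.mem_univ _)) r
  have hr : r ∘ e ∘ r = r := funext fun i => hre (r i)
  simp only [eval_rename, hr, hS, hT] at h
  exact hqp.ne h

/-- Under the hypotheses of `exists_assignment_of_critical_pair`, there is a homomorphism onto `L`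
from a sublattice of `L'`. Here `β` takes each element to its least preimage and `e` is the
greatest preimage of `z`. -/
theorem exists_lift_of_critical_pair {L L' : Type*} [Lattice L] [Lattice L'] [Finite L]
    [Finite L'] (hV : ∀ e, Satisfies L' e → Satisfies L e) {p q : L} (hqp : q < p)
    (hcrit : ∀ a b : L, a < b → ∃ c x : L, (a ⊓ c ⊔ x) ⊓ p ≤ q ∧ p ≤ b ⊓ c ⊔ x) (z : L) :
    ∃ (β : L → L') (e : L'), (∀ x y y', x ≤ y ⊔ y' → β x ≤ β y ⊔ β y') ∧
      (∀ x y, x ⊓ y ≤ z → β x ⊓ β y ≤ e) ∧ ∀ x y, β x ≤ β y ⊔ e → x ≤ y ⊔ z := by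
  obtain ⟨k, ⟨g⟩⟩ := Finite.exists_equiv_fin L
  let code : L → ℕ := fun x => g x
  have hcode : Function.Injective code := fun x y h => g.injective (Fin.ext h)
  have : Nonempty L := ⟨z⟩
  let r : ℕ → L := Function.invFun code
  have hr (x : L) : r (code x) = x := Function.leftInverse_invFun hcode x
  obtain ⟨w, hw⟩ := exists_assignment_of_critical_pair hV hqp hcrit r code hr
  have hmin (x : L) : ∃ t : LatticeTerm, t.eval r = x ∧
      ∀ s : LatticeTerm, x ≤ s.eval r → t.eval w ≤ s.eval w := by
    obtain ⟨_, ⟨⟨t, ht, rfl⟩, hmin⟩⟩ :=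
      (Set.toFinite {y : L' | ∃ t : LatticeTerm, t.eval r = x ∧ t.eval w = y}).exists_minimal
        ⟨_, var (code x), hr x, rfl⟩
    refine ⟨t, ht, fun s hs => ?_⟩
    have h := hmin (y := (meet t s).eval w)
      ⟨meet t s, by rw [eval, ht, inf_eq_left.2 hs], rfl⟩ inf_le_left
    exact h.trans inf_le_right
  have hmax : ∃ t : LatticeTerm, t.eval r = z ∧
      ∀ s : LatticeTerm, s.eval r ≤ z → s.eval w ≤ t.eval w := by
    obtain ⟨_, ⟨⟨t, ht, rfl⟩, hmax⟩⟩ :=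
      (Set.toFinite {y : L' | ∃ t : LatticeTerm, t.eval r = z ∧ t.eval w = y}).exists_maximal
        ⟨_, var (code z), hr z, rfl⟩
    refine ⟨t, ht, fun s hs => ?_⟩
    have h := hmax (y := (join t s).eval w)
      ⟨join t s, by rw [eval, ht, sup_eq_left.2 hs], rfl⟩ le_sup_left
    exact le_sup_right.trans h
  choose τ hτ hτle using hmin
  obtain ⟨ε, hε, hεle⟩ := hmax
  refine ⟨fun x => (τ x).eval w, ε.eval w, fun x y y' h => ?_, fun x y h => ?_, fun x y h => ?_⟩
  · exact hτle x (join (τ y) (τ y')) (by rwa [eval, hτ, hτ])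
  · exact hεle (meet (τ x) (τ y)) (by rwa [eval, hτ, hτ])
  · simpa only [eval, hτ, hε] using hw (τ x) (join (τ y) ε) h

/-! ### The lattices `Lmn m n` -/

instance {P : Type*} [PartialOrder P] [Finite P] : Finite (Co P) :=
  Finite.of_injective _ (SetLike.coe_injective (A := Co P))

namespace Lmn

variable {m n : ℕ}

theorem le_iff {X Y : Lmn m n} : X ≤ Y ↔ ∀ i, i ∈ X.1 → i ∈ Y.1 := Iff.rfl

theorem mem_inf {X Y : Lmn m n} {i : Fin (m + n + 1)} :
    i ∈ (X ⊓ Y).1 ↔ i ∈ X.1 ∧ i ∈ Y.1 := Iff.rfl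

theorem mem_sup {X Y : Lmn m n} {z : Fin (m + n + 1)} :
    z ∈ (X ⊔ Y).1 ↔
      ∃ x, (x ∈ X.1 ∨ x ∈ Y.1) ∧ ∃ y, (y ∈ X.1 ∨ y ∈ Y.1) ∧ x ≤ z ∧ z ≤ y := Iff.rfl

/-- The empty set. -/
def empty (m n : ℕ) : Lmn m n := ⟨⟨∅, Set.ordConnected_empty⟩, fun h => h.elim⟩

theorem not_mem_empty (i : Fin (m + n + 1)) : i ∉ (empty m n).1 := fun h => h

/-- The least member of `Lmn m n` that contains `i`: it is `{m - 1, m}` for `i = m`, and `{i}`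
otherwise. -/
def point (hm : 0 < m) (i : Fin (m + n + 1)) : Lmn m n :=
  ⟨⟨{j | j.val = i.val ∨ i.val = m ∧ j.val + 1 = m}, ⟨by
    rintro x hx y hy z ⟨hxz, hzy⟩
    simp only [Set.mem_ofPred_eq, Fin.le_def] at *
    omega⟩⟩, fun h => by
    change _ ∨ _ at h
    change _ ∨ _
    dsimp only at *
    omega⟩

theorem mem_point {hm : 0 < m} {i j : Fin (m + n + 1)} :
    j ∈ (point hm i).1 ↔ j.val = i.val ∨ i.val = m ∧ j.val + 1 = m := Iff.rfl

theorem pred_mem (X : Lmn m n) {i j : Fin (m + n + 1)} (hi : i.val = m) (hj : j.val = m - 1)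
    (h : i ∈ X.1) : j ∈ X.1 := by
  rw [(Fin.ext hi : i = ⟨m, by omega⟩)] at h
  rw [(Fin.ext hj : j = ⟨m - 1, by omega⟩)]
  exact X.2 h

/-- `{m - 1} < {m - 1, m}` is a critical pair of `Lmn m n`. -/
theorem critical_pair (hm : 0 < m) (hn : 0 < n) {i j : Fin (m + n + 1)} (hi : i.val = m)
    (hj : j.val + 1 = m) (a b : Lmn m n) (hab : a < b) :
    ∃ c x : Lmn m n, (a ⊓ c ⊔ x) ⊓ point hm i ≤ point hm j ∧ point hm i ≤ b ⊓ c ⊔ x := by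
  obtain ⟨k, hkb, hka⟩ : ∃ k, k ∈ b.1 ∧ k ∉ a.1 := by
    by_contra! h
    exact hab.not_ge (le_iff.2 h)
  -- A point `k` on one side of the pair is joined with a point such that the hull covers `m - 1`
  -- and `m`: with `m + 1` from the left (hence `0 < n`), with `m - 1` from the right.
  rcases lt_trichotomy k.val m with hk | hk | hk
  · let l : Fin (m + n + 1) := ⟨m + 1, by omega⟩
    refine ⟨point hm k, point hm l, ?_, ?_⟩
    · have h : a ⊓ point hm k ≤ point hm l := le_iff.2 fun y hy => by
        obtain ⟨hya, hyk⟩ := mem_inf.1 hy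
        rw [mem_point] at hyk
        obtain rfl : y = k := Fin.ext (by omega)
        exact absurd hya hka
      rw [sup_eq_right.2 h]
      refine le_iff.2 fun y hy => ?_
      simp only [mem_inf, mem_point, l] at hy ⊢
      omega
    · refine le_iff.2 fun y hy => mem_sup.2
        ⟨k, Or.inl (mem_inf.2 ⟨hkb, mem_point.2 (Or.inl rfl)⟩), l,
          Or.inr (mem_point.2 (Or.inl rfl)), ?_⟩
      simp only [mem_point, Fin.le_def, l] at hy ⊢
      omega
  · obtain rfl : k = i := Fin.ext (by omega)
    refine ⟨point hm k, point hm j, ?_, ?_⟩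
    · refine inf_le_left.trans (sup_le (le_iff.2 fun y hy => ?_) le_rfl)
      obtain ⟨hya, hyk⟩ := mem_inf.1 hy
      have hne : y.val ≠ k.val := fun h => hka (Fin.ext h ▸ hya)
      rw [mem_point] at hyk ⊢
      omega
    · refine le_sup_of_le_left (le_inf (le_iff.2 fun y hy => ?_) le_rfl)
      rcases mem_point.1 hy with h | h
      · rwa [Fin.ext h]
      · exact pred_mem b hi (by omega) hkb
  · refine ⟨point hm k, point hm j, ?_, ?_⟩
    · refine inf_le_left.trans (sup_le (le_iff.2 fun y hy => ?_) le_rfl)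
      obtain ⟨hya, hyk⟩ := mem_inf.1 hy
      rw [mem_point] at hyk
      obtain rfl : y = k := Fin.ext (by omega)
      exact absurd hya hka
    · refine le_iff.2 fun y hy => mem_sup.2
        ⟨j, Or.inr (mem_point.2 (Or.inl rfl)), k,
          Or.inl (mem_inf.2 ⟨hkb, mem_point.2 (Or.inl rfl)⟩), ?_⟩
      simp only [mem_point, Fin.le_def] at hy ⊢
      omega

theorem point_lt_point (hm : 0 < m) {i j : Fin (m + n + 1)} (hi : i.val = m)
    (hj : j.val + 1 = m) : point hm j < point hm i := by
  refine lt_of_le_of_ne (le_iff.2 fun y hy => ?_) fun h => ?_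
  · rw [mem_point] at hy ⊢
    omega
  · have := mem_point.1 (h ▸ mem_point.2 (Or.inl rfl) : i ∈ (point hm j).1)
    omega

theorem point_inf_point_le_empty (hm : 0 < m) {i j : Fin (m + n + 1)} (hij : i ≠ j)
    (h₁ : ¬ (i.val = m ∧ j.val + 1 = m)) (h₂ : ¬ (j.val = m ∧ i.val + 1 = m)) :
    point hm i ⊓ point hm j ≤ empty m n := by
  refine le_iff.2 fun y hy => ?_
  rw [mem_inf, mem_point, mem_point] at hy
  have := Fin.val_ne_of_ne hij
  omega

theorem point_le_point_sup_point (hm : 0 < m) {i j k : Fin (m + n + 1)} (hij : i < j)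
    (hjk : j < k) : point hm j ≤ point hm i ⊔ point hm k := by
  refine le_iff.2 fun y hy => mem_sup.2
    ⟨i, Or.inl (mem_point.2 (Or.inl rfl)), k, Or.inr (mem_point.2 (Or.inl rfl)), ?_⟩
  simp only [mem_point, Fin.le_def, Fin.lt_def] at *
  omega

end Lmn

/-! ### Maps between finite chains -/

theorem val_eq_of_strictMono {a b : ℕ} (hab : a = b) {f : Fin a → Fin b} (hf : StrictMono f)
    (i : Fin a) : (f i).val = i.val := by
  subst hab
  have h : f = id := (StrictMono.range_inj hf strictMono_id).1 (by
    rw [(Finite.surjective_of_injective hf.injective).range_eq, Set.range_id])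
  rw [h, id]

/-- An injective map from a finite chain is monotone or antitone if it preserves betweenness for
all intervals whose ends differ from a given inner point. -/
theorem strictMono_or_strictAnti_of_between {N : ℕ} {α : Type*} [LinearOrder α]
    {f : Fin (N + 1) → α} (hf : Function.Injective f) {c : Fin (N + 1)} (hc₀ : c ≠ 0)
    (hc₁ : c ≠ Fin.last N)
    (hbtw : ∀ i j k, i < j → j < k → i ≠ c → k ≠ c →
      f i < f j ∧ f j < f k ∨ f k < f j ∧ f j < f i) :
    StrictMono f ∨ StrictAnti f := by
  have aux : ∀ {β : Type _} [LinearOrder β] (f : Fin (N + 1) → β),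
      (∀ i j k, i < j → j < k → i ≠ c → k ≠ c →
        f i < f j ∧ f j < f k ∨ f k < f j ∧ f j < f i) →
      f 0 < f (Fin.last N) → StrictMono f := by
    intro β _ f hbtw h0
    have h1 (j) (hj : 0 < j) : f 0 < f j := by
      rcases (Fin.le_last j).eq_or_lt with rfl | hl
      · exact h0
      · rcases hbtw 0 j _ hj hl hc₀.symm hc₁.symm with h | h
        · exact h.1
        · exact absurd (h.1.trans h.2) h0.not_gt
    have h2 (i j) (hij : i < j) (hj : j ≠ c) : f i < f j := by
      rcases (Fin.zero_le i).eq_or_lt with rfl | hi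
      · exact h1 j hij
      · rcases hbtw 0 i j hi hij hc₀.symm hj with h | h
        · exact h.2
        · exact absurd (h.1.trans h.2) (h1 j (hi.trans hij)).not_gt
    intro i j hij
    -- Betweenness is not available with `c` as an end, so `c` serves as the inner point, with the
    -- last element as right end.
    rcases eq_or_ne j c with rfl | hj
    · have hl := lt_of_le_of_ne (Fin.le_last j) hc₁
      rcases hbtw i j _ hij hl hij.ne hc₁.symm with h | h
      · exact h.1
      · exact absurd (h.1.trans h.2) (h2 i _ (hij.trans hl) hc₁.symm).not_gt
    · exact h2 i j hij hj
  have hne : f 0 ≠ f (Fin.last N) := fun h =>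
    hc₀ (le_antisymm ((Fin.le_last c).trans (hf h).ge) (Fin.zero_le c))
  rcases hne.lt_or_gt with h | h
  · exact Or.inl (aux f hbtw h)
  · refine Or.inr fun i j hij => ?_
    exact aux (OrderDual.toDual ∘ f)
      (fun i j k hij hjk hi hk => (hbtw i j k hij hjk hi hk).symm.imp And.symm And.symm) h hij

/-! ### Recovering `m` from the variety -/

open Lmn in
theorem eq_of_mem_V {m n m' n' : ℕ} (hm : 0 < m) (hn : 0 < n) (hm' : 0 < m')
    (hsum : m + n = m' + n') (hV : Lat.of (Lmn m n) ∈ V (Lmn m' n')) : m = m' := by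
  let c : Fin (m + n + 1) := ⟨m, by omega⟩
  let d : Fin (m + n + 1) := ⟨m - 1, by omega⟩
  have hcm : c.val = m := rfl
  have hdm : d.val + 1 = m := Nat.sub_add_cancel hm
  obtain ⟨β, e, hsup, hinf, hle⟩ := exists_lift_of_critical_pair
    (L' := Lmn m' n') (fun _ h => Satisfies.of_mem_V hV h) (point_lt_point hm hcm hdm)
    (critical_pair hm hn hcm hdm) (empty m n)
  let A : Fin (m + n + 1) → Lmn m' n' := fun i => β (point hm i)
  have hdisj {i j : Fin (m + n + 1)} (hij : i ≠ j) (h₁ : ¬ (i.val = m ∧ j.val + 1 = m))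
      (h₂ : ¬ (j.val = m ∧ i.val + 1 = m)) {y : Fin (m' + n' + 1)} (hi : y ∈ (A i).1)
      (hj : y ∈ (A j).1) : y ∈ e.1 :=
    le_iff.1 (hinf _ _ (point_inf_point_le_empty hm hij h₁ h₂)) y (mem_inf.2 ⟨hi, hj⟩)
  -- Otherwise `A i ≤ e`, or `A c ≤ A d ⊔ e`; mapped back to `Lmn m n`, these put `i` in `∅`, or `m`
  -- in `{m - 1}`.
  have hex (i : Fin (m + n + 1)) : ∃ y, y ∈ (A i).1 ∧ y ∉ e.1 ∧ (i = c → y ∉ (A d).1) := by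
    by_contra! h
    have hi : A i ≤ A d ⊔ e → i.val ≠ m → False := fun _ hne => by
      have h' : A i ≤ β (empty m n) ⊔ e := le_sup_of_le_right (le_iff.2 fun y hy => by
        by_contra hye
        exact hne (congrArg Fin.val (h y hy hye).1))
      have := le_iff.1 (hle _ _ h') i (mem_point.2 (Or.inl rfl))
      rw [sup_idem] at this
      exact not_mem_empty i this
    have hi' : A i ≤ A d ⊔ e := le_iff.2 fun y hy => by
      by_cases hye : y ∈ e.1
      · exact le_iff.1 (le_sup_right : e ≤ A d ⊔ e) y hye
      · exact le_iff.1 (le_sup_left : A d ≤ A d ⊔ e) y (h y hy hye).2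
    by_cases him : i.val = m
    · have h' := hle _ _ hi'
      rw [sup_eq_left.2 (le_iff.2 fun y hy => absurd hy (not_mem_empty y))] at h'
      have := mem_point.1 (le_iff.1 h' i (mem_point.2 (Or.inl rfl)))
      omega
    · exact hi hi' him
  choose f hfA hfe hfd using hex
  have hf : Function.Injective f := by
    intro i j hij
    by_contra hne
    have hj : f i ∈ (A j).1 := hij ▸ hfA j
    by_cases h₁ : i.val = m ∧ j.val + 1 = m
    · obtain rfl : j = d := Fin.ext (by omega)
      exact hfd i (Fin.ext h₁.1) hj
    by_cases h₂ : j.val = m ∧ i.val + 1 = m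
    · obtain rfl : i = d := Fin.ext (by omega)
      exact hfd j (Fin.ext h₂.1) (hij ▸ hfA d)
    exact hfe i (hdisj hne h₁ h₂ (hfA i) hj)
  have hsurj : Function.Surjective f :=
    ((Fintype.bijective_iff_injective_and_card f).2 ⟨hf, by simp [hsum]⟩).2
  -- Since `f` is onto, another point of `A i` would be some `f j`, which the choice of `f j`
  -- forbids.
  have hA (i) (hi : i ≠ c) (y) (hy : y ∈ (A i).1) : y = f i := by
    obtain ⟨j, rfl⟩ := hsurj y
    by_contra hne
    have hij : i ≠ j := fun h => hne (h ▸ rfl)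
    by_cases h₂ : j.val = m ∧ i.val + 1 = m
    · obtain rfl : i = d := Fin.ext (by omega)
      exact hfd j (Fin.ext h₂.1) hy
    · exact hfe j (hdisj hij (fun h => hi (Fin.ext h.1)) h₂ hy (hfA j))
  have hAc (y) (hy : y ∈ (A c).1) : y = f c ∨ y = f d := by
    obtain ⟨j, rfl⟩ := hsurj y
    by_contra! hne
    refine hfe j (hdisj (i := c) (j := j) (fun h => hne.1 (h ▸ rfl)) (fun h => ?_)
      (fun h => ?_) hy (hfA j))
    · exact hne.2 (congrArg f (Fin.ext (by omega)))
    · exact hne.1 (congrArg f (Fin.ext h.1))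
  have hbtw : ∀ i j k, i < j → j < k → i ≠ c → k ≠ c →
      f i < f j ∧ f j < f k ∨ f k < f j ∧ f j < f i := by
    intro i j k hij hjk hi hk
    have hji : f j ≠ f i := fun h => hij.ne' (hf h)
    have hjk' : f j ≠ f k := fun h => hjk.ne (hf h)
    obtain ⟨x, hx, y, hy, hxj, hjy⟩ :=
      mem_sup.1 (le_iff.1 (hsup _ _ _ (point_le_point_sup_point hm hij hjk)) (f j) (hfA j))
    have hx' : x = f i ∨ x = f k := hx.imp (hA i hi x) (hA k hk x)
    have hy' : y = f i ∨ y = f k := hy.imp (hA i hi y) (hA k hk y)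
    rcases hx' with rfl | rfl <;> rcases hy' with rfl | rfl
    · exact absurd (le_antisymm hjy hxj) hji
    · exact Or.inl ⟨lt_of_le_of_ne hxj hji.symm, lt_of_le_of_ne hjy hjk'⟩
    · exact Or.inr ⟨lt_of_le_of_ne hxj hjk'.symm, lt_of_le_of_ne hjy hji⟩
    · exact absurd (le_antisymm hjy hxj) hjk'
  have hfc : (f c).val = m' := by
    obtain ⟨i, hi⟩ := hsurj ⟨m', by omega⟩
    have him : (f i).val = m' := congrArg Fin.val hi
    rcases eq_or_ne i c with rfl | hne
    · exact him
    · have := hA i hne ⟨m' - 1, by omega⟩ (pred_mem (A i) him rfl (hfA i))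
      have := congrArg Fin.val this
      dsimp only at this
      omega
  have hc₀ : c ≠ 0 := fun h => hm.ne' (congrArg Fin.val h)
  have hc₁ : c ≠ Fin.last (m + n) := fun h => by
    have : m = m + n := congrArg Fin.val h
    omega
  rcases strictMono_or_strictAnti_of_between hf hc₀ hc₁ hbtw with h | h
  · rw [← hfc, val_eq_of_strictMono (by rw [hsum]) h]
  -- Here `m' - 1` must be `f c` or `f d`, but `f c = m'` and `f d` is larger still.
  · have hdc : f c < f d := h (Fin.lt_def.2 (by omega))
    rcases hAc ⟨m' - 1, by omega⟩ (pred_mem (A c) hfc rfl (hfA c)) with h | h <;>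
    · have := congrArg Fin.val h
      rw [Fin.lt_def] at hdc
      dsimp only at this
      omega

end ConvexLattice

theorem propositionP :
    (∀ m n m' n' : ℕ, 0 < m → 0 < n → 0 < m' → 0 < n' → m + n = m' + n' →
      Lat.of (ConvexLattice.Lmn m n) ∈ ConvexLattice.V (ConvexLattice.Lmn m' n') →
      (m, n) = (m', n')) ∧
    (∀ k l k' l' : ℕ, 0 < k → 0 < l → 0 < k' → 0 < l' → k + l = k' + l' →
      (k, l) ≠ (k', l') →
      ¬ ConvexLattice.V (ConvexLattice.Lmn k l) ⊆ ConvexLattice.V (ConvexLattice.Lmn k' l') ∧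
      ¬ ConvexLattice.V (ConvexLattice.Lmn k' l') ⊆ ConvexLattice.V (ConvexLattice.Lmn k l)) := by
  have key (m n m' n' : ℕ) (hm : 0 < m) (hn : 0 < n) (hm' : 0 < m') (hsum : m + n = m' + n')
      (hV : Lat.of (ConvexLattice.Lmn m n) ∈ ConvexLattice.V (ConvexLattice.Lmn m' n')) :
      (m, n) = (m', n') := by
    have := ConvexLattice.eq_of_mem_V hm hn hm' hsum hV
    exact Prod.ext this (by dsimp only; omega)
  refine ⟨fun m n m' n' hm hn hm' _ => key m n m' n' hm hn hm', ?_⟩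
  intro k l k' l' hk hl hk' hl' hsum hne
  exact ⟨fun h => hne (key k l k' l' hk hl hk' hsum (h (ConvexLattice.of_mem_V _))),
    fun h => hne (key k' l' k l hk' hl' hk hsum.symm (h (ConvexLattice.of_mem_V _))).symm⟩
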